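/- **Network models.** A network with nodes $w_1,\dots,w_L$, external signals $r_1,\dots,r_K$ and a white noise $e$ with components $e_1,\dots,e_p$ ($p\le L$) is described by $w=Gw+Rr+He$. A network model is a quadruple $(G,R,H,\Lambda)$ with $G\in\mathbb R(z)^{L\times L}$ having zero diagonal and proper stable entries (the modules); $R\in\mathbb R(z)^{L\times K}$ proper; $H\in\mathbb R(z)^{L\times p}$ proper and stable with a stable left inverse and with $[I_p\ 0]\,H(\infty)=I_p$; $\Lambda\in\mathbb R^{p\times p}$ positive definite; $I-G(\infty)$ invertible with all principal minors of its inverse nonzero, and $(I-G)^{-1}$ existing, proper and stable. Its transfer function from excitations to nodes is $T=(I-G)^{-1}[R\ \ H]$. **Model sets.** Let $\mathcal M=\{(G(q,\theta),R(q,\theta),H(q,\theta),\Lambda(\theta)) : \theta\in\Theta\}$ be a set of network models in which each entry of $G,R,H$ is either a known element of $\mathbb R(z)$ (possibly $0$), or parametrized in one of the forms $$\frac{b_0+\dots+b_{m-1}z^{m-1}}{a_0+\dots+a_{n-1}z^{n-1}+z^n}\ \ (m\ge1,\ n\ge 0),\qquad \frac{b_0+\dots+b_{n-1}z^{n-1}+z^n}{a_0+\dots+a_{n-1}z^{n-1}+z^n}\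 \ (n\ge1),$$ where the orders $m,n$ are arbitrary and may differ from entry to entry, and different entries have no parameters in common. The vector $\theta$ consists of all these coefficients and of finitely many further real parameters; $\Lambda(\theta)$ may be any function of $\theta$. The parameter set $\Theta$ is any set of parameter vectors that is not a Lebesgue null set and for which all $M(\theta)$, $\theta\in\Theta$, are network models. Assume that the known entries are non-degenerate: if $N$ denotes the matrix obtained from $[\,I-G\ \ R\ \ H\,]$ by replacing all parametrized entries of $G,R,H$ by $0$, then every square submatrix of $N$ whose determinant has a nonzero term in its Leibniz expansion is nonsingular. (This is automatic if no nonzero entry is known, and also if no nonzero entry of $G$ is known and each column, or each row, of $[R\ H]$ has at most one known nonzero entry.) **Paths.** The network graph has the nodes $w_j$ and the excitations $r_k,e_l$ as vertices, and an edge from a vertex $s$ to a node $w_j$ whenever the transfer function from $s$ to $w_j$ (the corresponding entry of $G$, $R$ or $H$) is not identically zero on $\Theta$. Paths are disjoint if no two of them have a vertex in common, start and end vertices included. **Proposition.** Suppose that all modules $G_{jl}(q,\theta)$, $\theta\in\Theta$, are strictly proper. Let $\mathcal U$ be a set of excitations $r_k,e_l$ and $\mathcal Y$ a set of nodes. Then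 the maximum number of disjoint paths from excitations in $\mathcal U$ to nodes in $\mathcal Y$ is equal to the generic rank of the submatrix $T_{\mathcal Y\mathcal U}(q,\theta)$ of $T(q,\theta)$ with rows $\mathcal Y$ and columns $\mathcal U$, i.e. for Lebesgue-almost all $\theta\in\Theta$ the rank of $T_{\mathcal Y\mathcal U}(q,\theta)$ over $\mathbb R(z)$ is equal to that number. -/

import Mathlib

open MeasureTheory Polynomial

noncomputable section

namespace DynNet

/-! ### Rational transfer functions -/

/-- The transfer function `f ∈ ℝ(z)` is proper (`f(∞)` is finite). -/
def IsProper (f : RatFunc ℝ) : Prop := f.num.degree ≤ f.denom.degree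

/-- The transfer function `f ∈ ℝ(z)` is strictly proper (`f(∞) = 0`). -/
def IsStrictlyProper (f : RatFunc ℝ) : Prop := f.num.degree < f.denom.degree

/-- Discrete-time stability: all poles lie in the open unit disc. -/
def IsStable (f : RatFunc ℝ) : Prop := ∀ z : ℂ, aeval z f.denom = 0 → ‖z‖ < 1

/-- The value `f(∞)` of a proper transfer function (`f.denom` is monic). -/
def valueAtInfty (f : RatFunc ℝ) : ℝ := f.num.coeff f.denom.natDegree

/-! ### Network models -/

/-- The excitations: `Sum.inl k` is the external signal `r_k`, `Sum.inr l` is the noise `e_l`. -/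
abbrev Excitation (K p : ℕ) := Fin K ⊕ Fin p

/-- All signals of the network: `Sum.inl j` is the node `w_j`, `Sum.inr u` is an excitation. -/
abbrev Signal (L K p : ℕ) := Fin L ⊕ Excitation K p

/-- The data `(G, R, H, Λ)` of a network with `L` nodes, `K` external signals and a
`p`-dimensional white noise: `w = G w + R r + H e`, with `Λ` the covariance of `e`. -/
structure NetworkData (L K p : ℕ) where
  G : Matrix (Fin L) (Fin L) (RatFunc ℝ)
  R : Matrix (Fin L) (Fin K) (RatFunc ℝ)
  H : Matrix (Fin L) (Fin p) (RatFunc ℝ)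
  cov : Matrix (Fin p) (Fin p) ℝ

/-- The network transfer function `T = (I - G)⁻¹ [R H]` from all excitations to all nodes. -/
def NetworkData.transfer {L K p : ℕ} (M : NetworkData L K p) :
    Matrix (Fin L) (Excitation K p) (RatFunc ℝ) :=
  (1 - M.G)⁻¹ * Matrix.fromCols M.R M.H

/-- `(G, R, H, Λ)` is a network model. -/
structure IsNetworkModel {L K p : ℕ} (hp : p ≤ L) (M : NetworkData L K p) : Prop where
  diag_zero : ∀ j, M.G j j = 0
  modules_proper : ∀ j l, IsProper (M.G j l)
  modules_stable : ∀ j l, IsStable (M.G j l)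
  R_proper : ∀ j k, IsProper (M.R j k)
  H_proper : ∀ j l, IsProper (M.H j l)
  H_stable : ∀ j l, IsStable (M.H j l)
  /-- `H` has a stable left inverse. -/
  H_leftInverse : ∃ N : Matrix (Fin p) (Fin L) (RatFunc ℝ),
    (∀ i j, IsStable (N i j)) ∧ N * M.H = 1
  /-- `[I_p 0] H` is monic: its value at infinity is `I_p`. -/
  H_monic : ∀ i l : Fin p,
    IsStrictlyProper (M.H (Fin.castLE hp i) l - (1 : Matrix (Fin p) (Fin p) (RatFunc ℝ)) i l)
  cov_posDef : M.cov.PosDef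
  /-- Well-posedness: `I - G(∞)` is invertible and all principal minors of its inverse are
  nonzero. -/
  wellPosed_isUnit : IsUnit (1 - M.G.map valueAtInfty).det
  wellPosed_minors : ∀ S : Finset (Fin L),
    ((1 - M.G.map valueAtInfty)⁻¹.submatrix (Subtype.val : S → Fin L) Subtype.val).det ≠ 0
  /-- `(I - G)⁻¹` exists and is proper and stable. -/
  isUnit_det : IsUnit (1 - M.G).det
  inv_proper : ∀ j l, IsProper ((1 - M.G)⁻¹ j l)
  inv_stable : ∀ j l, IsStable ((1 - M.G)⁻¹ j l)

/-! ### Parametrized model sets -/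

/-- How a single transfer function (an entry of `G`, `R` or `H`) is modelled. -/
inductive Entry where
  /-- A known (not parametrized) transfer function, possibly zero. -/
  | fixed (f : RatFunc ℝ)
  /-- `(b_0 + ⋯ + b_{m-1} z^{m-1}) / (a_0 + ⋯ + a_{n-1} z^{n-1} + z^n)`, all `b_i`, `a_i` free. -/
  | param (m n : ℕ) (hm : 0 < m)
  /-- `(b_0 + ⋯ + b_{n-1} z^{n-1} + z^n) / (a_0 + ⋯ + a_{n-1} z^{n-1} + z^n)`, all `b_i`, `a_i`
  free: the monic transfer functions of order `n`. -/
  | monic (n : ℕ) (hn : 0 < n)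

/-- Number of free numerator coefficients. -/
def Entry.numLen : Entry → ℕ
  | .fixed _ => 0
  | .param m _ _ => m
  | .monic n _ => n

/-- Number of free denominator coefficients. -/
def Entry.denLen : Entry → ℕ
  | .fixed _ => 0
  | .param _ n _ => n
  | .monic n _ => n

/-- The parameters of an entry: its free numerator and denominator coefficients. -/
abbrev Entry.Coeff (e : Entry) : Type := (Fin e.numLen → ℝ) × (Fin e.denLen → ℝ)

/-- The polynomial `x_0 + x_1 z + ⋯ + x_{n-1} z^{n-1}`. -/
def lowPoly {n : ℕ} (x : Fin n → ℝ) : ℝ[X] := ∑ i, C (x i) * X ^ (i : ℕ)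

/-- The transfer function of an entry at given parameter values. -/
def Entry.eval : (e : Entry) → e.Coeff → RatFunc ℝ
  | .fixed f, _ => f
  | .param _ n _, x =>
      algebraMap ℝ[X] (RatFunc ℝ) (lowPoly x.1) /
        algebraMap ℝ[X] (RatFunc ℝ) (X ^ n + lowPoly x.2)
  | .monic n _, x =>
      algebraMap ℝ[X] (RatFunc ℝ) (X ^ n + lowPoly x.1) /
        algebraMap ℝ[X] (RatFunc ℝ) (X ^ n + lowPoly x.2)

/-- The known part of an entry: the transfer function itself if it is not parametrized, and `0`
if it is. -/
def Entry.known : Entry → RatFunc ℝ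
  | .fixed f => f
  | _ => 0

/-- The parameter vectors of a network: one separate block of coefficients for each entry of
`[G R H]` (no common parameters), and `d` further parameters for the noise covariance. -/
abbrev Params {L K p : ℕ} (entry : Fin L × Signal L K p → Entry) (d : ℕ) : Type :=
  ((e : Fin L × Signal L K p) → (entry e).Coeff) × (Fin d → ℝ)

/-- A network model set with independently parametrized transfer functions, `entry (j, s)`
being the one from the signal `s` to the node `w_j`. -/
structure NetworkModelSet (L K p : ℕ) where
  hp : p ≤ L
  entry : Fin L × Signal L K p → Entry
  d : ℕ
  /-- The noise covariance may depend on the parameters in any way. -/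
  cov : Params entry d → Matrix (Fin p) (Fin p) ℝ
  /-- The parameter set. -/
  Θ : Set (Params entry d)
  /-- The parameter set is not a null set, so that "almost all parameters" makes sense. -/
  volume_ne_zero : volume Θ ≠ 0
  /-- All members of the set are network models. -/
  isNetworkModel : ∀ θ ∈ Θ, IsNetworkModel hp
    { G := fun j l => (entry (j, Sum.inl l)).eval (θ.1 (j, Sum.inl l))
      R := fun j k => (entry (j, Sum.inr (Sum.inl k))).eval (θ.1 (j, Sum.inr (Sum.inl k)))
      H := fun j l => (entry (j, Sum.inr (Sum.inr l))).eval (θ.1 (j, Sum.inr (Sum.inr l)))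
      cov := cov θ }

namespace NetworkModelSet

variable {L K p : ℕ} (M : NetworkModelSet L K p)

/-- The transfer function from the signal `s` to the node `w_j` in the model `M(θ)`: an entry of
`G(q,θ)`, `R(q,θ)` or `H(q,θ)`. -/
def direct (θ : Params M.entry M.d) (j : Fin L) (s : Signal L K p) : RatFunc ℝ :=
  (M.entry (j, s)).eval (θ.1 (j, s))

/-- The model `M(θ) = (G(q,θ), R(q,θ), H(q,θ), Λ(θ))`. -/
def model (θ : Params M.entry M.d) : NetworkData L K p where
  G := fun j l => M.direct θ j (Sum.inl l)
  R := fun j k => M.direct θ j (Sum.inr (Sum.inl k))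
  H := fun j l => M.direct θ j (Sum.inr (Sum.inr l))
  cov := M.cov θ

/-- All modules of all models in the set are strictly proper. -/
def StrictlyProperModules : Prop :=
  ∀ θ ∈ M.Θ, ∀ j l, IsStrictlyProper ((M.model θ).G j l)

/-- The known part of `[I - G, R, H]`: the parametrized entries are replaced by `0`. -/
def knownPart : Matrix (Fin L) (Signal L K p) (RatFunc ℝ) :=
  Matrix.fromCols (1 - Matrix.of fun j l => (M.entry (j, Sum.inl l)).known)
    (Matrix.of fun j u => (M.entry (j, Sum.inr u)).known)

/-- The known entries are non-degenerate: a square submatrix of the known part of `[I - G, R, H]`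
with a nonvanishing term in the Leibniz expansion of its determinant is nonsingular, i.e. the rank
of each submatrix of it equals its structural rank (after a permutation of the columns, the
nonvanishing term is the one on the diagonal). In particular this holds if no nonzero entry is
known. -/
def KnownNondegenerate : Prop :=
  ∀ (n : ℕ) (rows : Fin n → Fin L) (cols : Fin n → Signal L K p),
    Function.Injective rows → Function.Injective cols →
    (∀ i, M.knownPart (rows i) (cols i) ≠ 0) →
    (M.knownPart.submatrix rows cols).det ≠ 0

/-- The network graph: an edge from the signal `s` to the node `w_j` whenever the transfer
function from `s` to `w_j` is not identically zero in the model set. -/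
def graph : Digraph (Signal L K p) where
  Adj s t := ∃ j : Fin L, t = Sum.inl j ∧ ∃ θ ∈ M.Θ, M.direct θ j s ≠ 0

/-- `P` is the list of signals along a path from an excitation in `U` to a node in `Y`. -/
def IsPath (U : Finset (Excitation K p)) (Y : Finset (Fin L)) (P : List (Signal L K p)) : Prop :=
  P.IsChain M.graph.Adj ∧ (∃ u ∈ U, P.head? = some (Sum.inr u)) ∧
    ∃ y ∈ Y, P.getLast? = some (Sum.inl y)

/-- There are `n` paths from excitations in `U` to nodes in `Y`, any two of which have no signal
in common (start and end included). -/
def HasDisjointPaths (U : Finset (Excitation K p)) (Y : Finset (Fin L)) (n : ℕ) : Prop :=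
  ∃ P : Fin n → List (Signal L K p),
    (∀ i, M.IsPath U Y (P i)) ∧ ∀ i j, i ≠ j → (P i).Disjoint (P j)

/-- The transfer `T_{YU}(q,θ)` from the excitations in `U` to the nodes in `Y`. -/
def transferYU (U : Finset (Excitation K p)) (Y : Finset (Fin L)) (θ : Params M.entry M.d) :
    Matrix Y U (RatFunc ℝ) :=
  (M.model θ).transfer.submatrix Subtype.val Subtype.val

/-- `T_{YU}(q,θ)` has generic rank `r`: it has rank `r` over `ℝ(z)` for almost all `θ ∈ Θ`. -/
def IsGenericRank (U : Finset (Excitation K p)) (Y : Finset (Fin L)) (r : ℕ) : Prop :=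
  ∀ᵐ θ : Params M.entry M.d, θ ∈ M.Θ → (M.transferYU U Y θ).rank = r

end NetworkModelSet

end DynNet

end

/-!
Multiplying by the invertible matrix `I - G`, the rank of `T_{YU}` can be read off the matrix
`[I - G, R, H]`: if `C` denotes the columns of the nodes outside `Y` and of the excitations in `U`,
then these columns have rank `|Yᶜ| + rank T_{YU}` (`NetworkModelSet.rank_system`). So the question
is about the rank of a matrix whose parametrized entries are independent of each other.

Call a set of positions in the columns `C`, no two in one row or column, a matching if each of
them is on the diagonal of `I - G` or belongs to an edge of the network graph. A matching of size
`|Yᶜ| + r` exists if and only if there are `r` disjoint paths from `U` to `Y`. Given the paths,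
every node on them is matched with its predecessor and every other node outside `Y` with itself
(`exists_isMatching_of_disjoint_walks`). Given the matching, one follows it from each matched
excitation until it stops; a count of the unmatched columns shows that at least `r` of
these paths stop in `Y` (`exists_disjoint_walks_of_isMatching`).

For each `θ ∈ Θ`, a nonzero minor of maximal size has a nonzero Leibniz term, which is a matching.
Hence there are at least `rank T_{YU}` disjoint paths (`NetworkModelSet.hasDisjointPaths_rank`).

Conversely, a matching gives a minor, and this minor is a polynomial in the parametrized entries. It
is not the zero polynomial: if the parametrized entries outside the matching are replaced by `0`
and those on the matching, up to sign, by one variable, its leading coefficient is the minor of the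
known part on the remaining positions of the matching. This minor does not vanish, because the
known part is nondegenerate (`NetworkModelSet.exists_systemMatrix_det_ne_zero`). A parametrized
entry takes each single value in `ℝ(z)` on a null set only (`volume_eval_eq`), and different entries
have different parameters. By Fubini's theorem a nonzero polynomial in such entries is nonzero
almost everywhere (`ae_eval_ne_zero`). So `r` disjoint paths force `rank T_{YU} ≥ r` for almost all
`θ ∈ Θ` (`NetworkModelSet.ae_le_rank`).
-/

namespace DynNet

/-! ### Minors and rank -/

section LinearAlgebra

variable {𝕜 : Type*} [Field 𝕜]

theorem exists_linearIndependent_col {m n : Type*} [Fintype m] [Fintype n] {A : Matrix m n 𝕜}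
    {r : ℕ} (hr : A.rank = r) :
    ∃ g : Fin r → n, LinearIndependent 𝕜 fun i => A.col (g i) := by
  subst hr
  have h := Submodule.exists_fun_fin_finrank_span_eq 𝕜 (Set.range A.col)
  rw [← Matrix.rank_eq_finrank_span_cols] at h
  obtain ⟨f, hf, -, hli⟩ := h
  choose g hg using hf
  refine ⟨g, ?_⟩
  simpa only [hg] using hli

theorem exists_submatrix_det_ne_zero {m n : Type*} [Fintype m] [Fintype n] (A : Matrix m n 𝕜) :
    ∃ (f : Fin A.rank → m) (g : Fin A.rank → n), (A.submatrix f g).det ≠ 0 := by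
  obtain ⟨g, hg⟩ := exists_linearIndependent_col (A := A) rfl
  have hrank : (A.submatrix id g).transpose.rank = A.rank := by
    simpa using LinearIndependent.rank_matrix (M := (A.submatrix id g).transpose) hg
  obtain ⟨f, hf⟩ := exists_linearIndependent_col hrank
  refine ⟨f, g, ?_⟩
  have h : IsUnit (A.submatrix f g) := Matrix.linearIndependent_rows_iff_isUnit.1 hf
  exact ((Matrix.isUnit_iff_isUnit_det _).1 h).ne_zero

theorem exists_perm_ne_zero_of_det_ne_zero {n : Type*} [Fintype n] [DecidableEq n]
    {A : Matrix n n 𝕜} (hA : A.det ≠ 0) : ∃ σ : Equiv.Perm n, ∀ i, A (σ i) i ≠ 0 := by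
  rw [Matrix.det_apply] at hA
  obtain ⟨σ, -, hσ⟩ := Finset.exists_ne_zero_of_sum_ne_zero hA
  refine ⟨σ, fun i hi => hσ ?_⟩
  have h0 : ∏ j, A (σ j) j = 0 := Finset.prod_eq_zero (Finset.mem_univ i) hi
  rw [h0, smul_zero]

theorem injective_of_submatrix_det_ne_zero {m n k : Type*} [Fintype k] [DecidableEq k]
    {A : Matrix m n 𝕜} {f : k → m} {g : k → n} (h : (A.submatrix f g).det ≠ 0) :
    Function.Injective f ∧ Function.Injective g := by
  constructor
  · intro i j hij
    by_contra hne
    exact h (Matrix.det_zero_of_row_eq hne (by ext; simp [hij]))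
  · intro i j hij
    by_contra hne
    exact h (Matrix.det_zero_of_column_eq hne (by simp [hij]))

theorem card_le_rank_of_submatrix_det_ne_zero {m n k : Type*} [Fintype m] [Fintype n] [Fintype k]
    [DecidableEq k] (A : Matrix m n 𝕜) {f : k → m} {g : k → n}
    (h : (A.submatrix f g).det ≠ 0) : Fintype.card k ≤ A.rank := by
  have h1 := Matrix.rank_of_isUnit _ ((Matrix.isUnit_iff_isUnit_det _).2 h.isUnit)
  rw [← h1]
  exact Matrix.rank_submatrix_le ..

/-- A matrix becomes nonsingular by adding a suitable multiple of the indicator of a set of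
diagonal positions, as soon as its principal minor on the remaining positions does not vanish. -/
theorem exists_det_add_diagonal_ne_zero [Infinite 𝕜] {n : Type*} [Fintype n] [DecidableEq n]
    (B : Matrix n n 𝕜) (q : n → Prop) [DecidablePred q]
    (hB : (B.submatrix (Subtype.val : {i // ¬ q i} → n) Subtype.val).det ≠ 0) :
    ∃ c : 𝕜, (B + Matrix.diagonal fun i => if q i then c else 0).det ≠ 0 := by
  set D := B.submatrix (Subtype.val : {i // ¬ q i} → n) Subtype.val
  set A := B.submatrix (Subtype.val : {i // q i} → n) Subtype.val
  set E := B.submatrix (Subtype.val : {i // q i} → n) (Subtype.val : {i // ¬ q i} → n)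
  set F := B.submatrix (Subtype.val : {i // ¬ q i} → n) (Subtype.val : {i // q i} → n)
  have : Invertible D := Matrix.invertibleOfIsUnitDet D hB.isUnit
  -- the Schur complement of `D` is singular only if `c` is a root of this characteristic polynomial
  obtain ⟨c, hc⟩ := (-(A - E * ⅟D * F)).charpoly.exists_eval_ne_zero_of_natDegree_lt_card
    (Matrix.charpoly_monic _).ne_zero 
    (Cardinal.natCast_lt_aleph0.trans_le (Cardinal.aleph0_le_mk 𝕜))
  refine ⟨c, ?_⟩
  have hblock : (B + Matrix.diagonal fun i => if q i then c else 0).submatrix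
      (Equiv.sumCompl q) (Equiv.sumCompl q) =
      Matrix.fromBlocks (A + Matrix.scalar _ c) E F D := by
    ext (i | i) (j | j)
    · simp [A, Matrix.diagonal_apply, i.2, Subtype.ext_iff]
    · have : (i : n) ≠ j := fun h => j.2 (h ▸ i.2)
      simp [E, this]
    · have : (i : n) ≠ j := fun h => i.2 (h ▸ j.2)
      simp [F, this]
    · simp [D, Matrix.diagonal_apply, i.2]
  rw [← Matrix.det_submatrix_equiv_self (Equiv.sumCompl q), hblock, Matrix.det_fromBlocks₂₂]
  refine mul_ne_zero hB ?_
  rw [Matrix.eval_charpoly] at hc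
  convert hc using 2
  abel

end LinearAlgebra

/-! ### Measurable families of rational functions -/

/-- A family of rational functions is measurable if it is the quotient of two families of
polynomials with measurable coefficients. This avoids a `σ`-algebra on `ℝ(z)`; what matters is
that such families are closed under the ring operations and have measurable zero sets. -/
def MeasurableFamily {α : Type*} [MeasurableSpace α] (F : α → RatFunc ℝ) : Prop :=
  ∃ P Q : α → ℝ[X], (∀ k, Measurable fun x => (P x).coeff k) ∧
    (∀ k, Measurable fun x => (Q x).coeff k) ∧ (∀ x, Q x ≠ 0) ∧
    ∀ x, F x = algebraMap ℝ[X] (RatFunc ℝ) (P x) / algebraMap ℝ[X] (RatFunc ℝ) (Q x)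

theorem measurable_coeff_mul {α : Type*} [MeasurableSpace α] {P Q : α → ℝ[X]}
    (hP : ∀ k, Measurable fun x => (P x).coeff k) (hQ : ∀ k, Measurable fun x => (Q x).coeff k)
    (k : ℕ) : Measurable fun x => (P x * Q x).coeff k := by
  simp only [coeff_mul]
  exact Finset.measurable_sum _ fun i _ => (hP i.1).mul (hQ i.2)

namespace MeasurableFamily

variable {α β : Type*} [MeasurableSpace α] [MeasurableSpace β]

theorem const (f : RatFunc ℝ) : MeasurableFamily fun _ : α => f :=
  ⟨fun _ => f.num, fun _ => f.denom, fun _ => measurable_const, fun _ => measurable_const,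
    fun _ => f.denom_ne_zero, fun _ => (RatFunc.num_div_denom f).symm⟩

theorem add {F G : α → RatFunc ℝ} (hF : MeasurableFamily F) (hG : MeasurableFamily G) :
    MeasurableFamily fun x => F x + G x := by
  obtain ⟨P, Q, hP, hQ, hQ0, h⟩ := hF
  obtain ⟨P', Q', hP', hQ', hQ0', h'⟩ := hG
  refine ⟨fun x => P x * Q' x + Q x * P' x, fun x => Q x * Q' x, fun k => ?_,
    measurable_coeff_mul hQ hQ', fun x => mul_ne_zero (hQ0 x) (hQ0' x), fun x => ?_⟩
  · simp only [coeff_add]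
    exact (measurable_coeff_mul hP hQ' k).add (measurable_coeff_mul hQ hP' k)
  · beta_reduce
    rw [h, h', div_add_div _ _ (RatFunc.algebraMap_ne_zero (hQ0 x))
      (RatFunc.algebraMap_ne_zero (hQ0' x))]
    simp only [map_add, map_mul]

theorem mul {F G : α → RatFunc ℝ} (hF : MeasurableFamily F) (hG : MeasurableFamily G) :
    MeasurableFamily fun x => F x * G x := by
  obtain ⟨P, Q, hP, hQ, hQ0, h⟩ := hF
  obtain ⟨P', Q', hP', hQ', hQ0', h'⟩ := hG
  refine ⟨fun x => P x * P' x, fun x => Q x * Q' x, measurable_coeff_mul hP hP',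
    measurable_coeff_mul hQ hQ', fun x => mul_ne_zero (hQ0 x) (hQ0' x), fun x => ?_⟩
  beta_reduce
  rw [h, h', div_mul_div_comm, map_mul, map_mul]

theorem comp {F : β → RatFunc ℝ} (hF : MeasurableFamily F) {g : α → β} (hg : Measurable g) :
    MeasurableFamily fun x => F (g x) := by
  obtain ⟨P, Q, hP, hQ, hQ0, h⟩ := hF
  exact ⟨fun x => P (g x), fun x => Q (g x), fun k => (hP k).comp hg, fun k => (hQ k).comp hg,
    fun x => hQ0 _, fun x => h _⟩

theorem eval {ι : Type*} {x : ι → α → RatFunc ℝ} (hx : ∀ i, MeasurableFamily (x i))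
    (p : MvPolynomial ι (RatFunc ℝ)) :
    MeasurableFamily fun a => MvPolynomial.eval (fun i => x i a) p := by
  induction p using MvPolynomial.induction_on with
  | C f => simpa using const f
  | add p q hp hq => simpa using hp.add hq
  | mul_X p i hp => simpa using hp.mul (hx i)

theorem measurableSet_zero {F : α → RatFunc ℝ} (hF : MeasurableFamily F) :
    MeasurableSet {x | F x = 0} := by
  obtain ⟨P, Q, hP, hQ, hQ0, h⟩ := hF
  have : {x | F x = 0} = ⋂ k, {x | (P x).coeff k = 0} := by
    ext x
    have hQ' := RatFunc.algebraMap_ne_zero (hQ0 x)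
    rw [Set.mem_ofPred_eq, h, div_eq_zero_iff, or_iff_left hQ',
      map_eq_zero_iff _ (RatFunc.algebraMap_injective ℝ), Polynomial.ext_iff]
    simp
  rw [this]
  exact MeasurableSet.iInter fun k => hP k (measurableSet_singleton 0)

end MeasurableFamily

/-! ### Polynomials in independent rational functions -/

/-- The independence principle `ae_eval_ne_zero` for the index type `Fin n`, by induction on `n` and
Fubini's theorem. -/
theorem ae_eval_ne_zero_fin {n : ℕ} {E : Fin n → Type*} [∀ i, MeasureSpace (E i)]
    [∀ i, SigmaFinite (volume : Measure (E i))] {x : ∀ i, E i → RatFunc ℝ}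
    (hx : ∀ i, MeasurableFamily (x i)) (p : MvPolynomial (Fin n) (RatFunc ℝ))
    (y : Fin n → RatFunc ℝ) (hp : MvPolynomial.eval y p ≠ 0)
    (hy : ∀ i, (∀ t, x i t = y i) ∨ ∀ c, volume {t | x i t = c} = 0) :
    ∀ᵐ θ : ∀ i, E i, MvPolynomial.eval (fun i => x i (θ i)) p ≠ 0 := by
  induction n with
  | zero =>
    refine Filter.Eventually.of_forall fun θ => ?_
    rwa [Subsingleton.elim (fun i => x i (θ i)) y]
  | succ n ih =>
    have hmp := volume_preserving_piFinSuccAbove E 0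
    suffices h : ∀ᵐ z : E 0 × (∀ j : Fin n, E (Fin.succAbove 0 j)),
        MvPolynomial.eval (Fin.cons (x 0 z.1) fun j => x _ (z.2 j)) p ≠ 0 by
      have h' := hmp.quasiMeasurePreserving.ae h
      filter_upwards [h'] with θ hθ
      convert hθ using 2
      congr 1
      funext i
      refine Fin.cases ?_ (fun j => ?_) i <;> rfl
    have hmeas : MeasurableSet {z : E 0 × (∀ j : Fin n, E (Fin.succAbove 0 j)) |
        MvPolynomial.eval (Fin.cons (x 0 z.1) fun j => x _ (z.2 j)) p ≠ 0} := by
      refine (MeasurableFamily.measurableSet_zero ?_).compl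
      have := MeasurableFamily.eval (ι := Fin (n + 1))
        (x := Fin.cons (fun z : E 0 × (∀ j : Fin n, E (Fin.succAbove 0 j)) => x 0 z.1)
          fun j z => x _ (z.2 j)) (fun i => ?_) p
      · convert this using 3 with z
        congr 1
        funext i
        refine Fin.cases ?_ (fun j => ?_) i <;> rfl
      · refine Fin.cases ?_ (fun j => ?_) i
        · exact (hx 0).comp measurable_fst
        · exact (hx _).comp ((measurable_pi_apply j).comp measurable_snd)
    refine (Measure.ae_prod_iff_ae_ae hmeas).2 ?_
    -- almost every value of the first variable keeps the polynomial nonzero at the rest of `y`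
    classical
    have hfirst : ∀ᵐ t : E 0, MvPolynomial.eval (Fin.cons (x 0 t) fun j => y j.succ) p ≠ 0 := by
      have hcons : (Fin.cons (y 0) fun j => y (Fin.succ j) : Fin (n + 1) → RatFunc ℝ) = y :=
        Fin.cons_self_tail y
      rcases hy 0 with h0 | h0
      · refine Filter.Eventually.of_forall fun t => ?_
        rwa [h0, hcons]
      · set f := ((MvPolynomial.finSuccEquiv (RatFunc ℝ) n p).map
          (MvPolynomial.eval fun j => y (Fin.succ j)))
        have hf (c) : MvPolynomial.eval (Fin.cons c fun j => y (Fin.succ j)) p = f.eval c :=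
          MvPolynomial.eval_eq_eval_mv_eval' _ _ _
        have hf0 : f ≠ 0 := by
          intro h
          rw [← hcons, hf, h, Polynomial.eval_zero] at hp
          exact hp rfl
        simp only [hf]
        have hsub : {t | ¬ f.eval (x 0 t) ≠ 0} ⊆
            ⋃ c ∈ (f.roots.toFinset : Set (RatFunc ℝ)), {t | x 0 t = c} := by
          intro t ht
          simpa [hf0] using ht
        refine measure_mono_null hsub ?_
        rw [measure_biUnion_null_iff (Finset.countable_toSet _)]
        exact fun c _ => h0 c
    filter_upwards [hfirst] with t ht
    set q : MvPolynomial (Fin n) (RatFunc ℝ) :=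
      MvPolynomial.aeval (Fin.cons (MvPolynomial.C (x 0 t)) MvPolynomial.X) p
    have hq (s : Fin n → RatFunc ℝ) :
        MvPolynomial.eval s q = MvPolynomial.eval (Fin.cons (x 0 t) s) p := by
      simp only [q]
      clear * -
      induction p using MvPolynomial.induction_on with
      | C f => simp
      | add p p' h h' => simp only [map_add, h, h']
      | mul_X p i h => 
        rw [map_mul, map_mul, map_mul, h, MvPolynomial.aeval_X, MvPolynomial.eval_X]
        refine Fin.cases ?_ (fun j => ?_) i <;> simp
    have := ih (x := fun j => x (Fin.succAbove 0 j)) (fun j => hx _) q (fun j => y j.succ)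
      (by rwa [hq]) (fun j => hy _)
    simpa only [hq] using this

/-- **Independence principle.** Let each of finitely many rational functions `x i` depend on a
parameter of its own, and either be constant or take every single value on a null set only. A
polynomial in the `x i` that does not vanish for some values of the nonconstant ones does not vanish
for almost all parameters. -/
theorem ae_eval_ne_zero {ι : Type*} [Fintype ι] {E : ι → Type*} [∀ i, MeasureSpace (E i)]
    [∀ i, SigmaFinite (volume : Measure (E i))] {x : ∀ i, E i → RatFunc ℝ}
    (hx : ∀ i, MeasurableFamily (x i)) (p : MvPolynomial ι (RatFunc ℝ))
    (y : ι → RatFunc ℝ) (hp : MvPolynomial.eval y p ≠ 0)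
    (hy : ∀ i, (∀ t, x i t = y i) ∨ ∀ c, volume {t | x i t = c} = 0) :
    ∀ᵐ θ : ∀ i, E i, MvPolynomial.eval (fun i => x i (θ i)) p ≠ 0 := by
  let e : Fin (Fintype.card ι) ≃ ι := (Fintype.equivFin ι).symm
  have h := ae_eval_ne_zero_fin (E := fun j => E (e j)) (x := fun j => x (e j)) (fun j => hx _)
    (MvPolynomial.rename e.symm p) (fun j => y (e j))
    (by rw [MvPolynomial.eval_rename]; convert hp; funext i; simp) (fun j => hy _)
  have hmp := (volume_measurePreserving_piCongrLeft E e).symm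
  have h' := hmp.quasiMeasurePreserving.ae h
  filter_upwards [h'] with θ hθ
  rw [MvPolynomial.eval_rename] at hθ
  convert hθ using 3
  funext i
  obtain ⟨j, rfl⟩ := e.surjective i
  change x (e j) (θ (e j)) = (fun i => x (e i) (θ (e i))) (e.symm (e j))
  rw [e.symm_apply_apply]

/-! ### Single entries -/

theorem Entry.eval_of_eq_fixed {e : Entry} {f : RatFunc ℝ} (he : e = .fixed f) (x : e.Coeff) :
    e.eval x = f := by
  subst he
  rfl

theorem lowPoly_coeff {n : ℕ} (x : Fin n → ℝ) (k : ℕ) :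
    (lowPoly x).coeff k = ∑ i : Fin n, if k = i then x i else 0 := by
  simp [lowPoly, coeff_X_pow]

theorem lowPoly_injective (n : ℕ) : Function.Injective (lowPoly (n := n)) := by
  intro x y h
  ext i
  have := congrArg (fun q => q.coeff (i : ℕ)) h
  simpa [lowPoly_coeff, Fin.val_inj] using this

theorem measurable_coeff_lowPoly {n : ℕ} (k : ℕ) :
    Measurable fun x : Fin n → ℝ => (lowPoly x).coeff k := by
  simp only [lowPoly_coeff]
  refine Finset.measurable_sum _ fun i _ => ?_
  split_ifs
  · exact measurable_pi_apply i
  · exact measurable_const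

theorem X_pow_add_lowPoly_ne_zero {n : ℕ} (x : Fin n → ℝ) : X ^ n + lowPoly x ≠ 0 := by
  intro h
  have := congrArg (fun q => q.coeff n) h
  have h0 : (lowPoly x).coeff n = 0 := by
    rw [lowPoly_coeff]
    exact Finset.sum_eq_zero fun i _ => if_neg i.2.ne'
  simp [h0] at this

theorem measurable_coeff_X_pow_add_lowPoly {n : ℕ} (k : ℕ) :
    Measurable fun x : Fin n → ℝ => (X ^ n + lowPoly x).coeff k := by
  simp only [coeff_add]
  exact measurable_const.add (measurable_coeff_lowPoly k)

theorem measurableFamily_eval (e : Entry) : MeasurableFamily e.eval := by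
  cases e with
  | fixed f => exact MeasurableFamily.const f
  | param m n hm =>
    exact ⟨fun x => lowPoly x.1, fun x => X ^ n + lowPoly x.2,
      fun k => (measurable_coeff_lowPoly k).comp measurable_fst,
      fun k => (measurable_coeff_X_pow_add_lowPoly k).comp measurable_snd,
      fun x => X_pow_add_lowPoly_ne_zero x.2, fun x => rfl⟩
  | monic n hn =>
    exact ⟨fun x => X ^ n + lowPoly x.1, fun x => X ^ n + lowPoly x.2,
      fun k => (measurable_coeff_X_pow_add_lowPoly k).comp measurable_fst,
      fun k => (measurable_coeff_X_pow_add_lowPoly k).comp measurable_snd,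
      fun x => X_pow_add_lowPoly_ne_zero x.2, fun x => rfl⟩

/-- A set of pairs whose second component determines the first one is null. -/
theorem volume_eq_zero_of_injOn_snd {m n : ℕ} (hm : 0 < m) {s : Set ((Fin m → ℝ) × (Fin n → ℝ))}
    (hs : MeasurableSet s) (h : Set.InjOn Prod.snd s) : volume s = 0 := by
  have : Nonempty (Fin m) := ⟨⟨0, hm⟩⟩
  rw [Measure.volume_eq_prod, Measure.prod_apply_symm hs]
  have h0 (a : Fin n → ℝ) : volume ((fun b : Fin m → ℝ => (b, a)) ⁻¹' s) = 0 := by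
    refine Set.Subsingleton.measure_zero (fun b hb b' hb' => ?_) _
    exact congrArg Prod.fst (h hb hb' rfl)
  simp [h0]

/-- A parametrized entry is equal to a given transfer function for almost no parameters: the
denominator coefficients and the given function determine the numerator coefficients. -/
theorem volume_eval_eq {e : Entry} (he : ∀ f, e ≠ .fixed f) (c : RatFunc ℝ) :
    volume {x : e.Coeff | e.eval x = c} = 0 := by
  have hs : MeasurableSet {x : e.Coeff | e.eval x = c} := by
    have := ((measurableFamily_eval e).add (MeasurableFamily.const (-c))).measurableSet_zero
    simpa only [add_neg_eq_zero] using this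
  cases e with
  | fixed f => exact absurd rfl (he f)
  | param m n hm =>
    refine volume_eq_zero_of_injOn_snd hm hs ?_
    rintro ⟨b, a⟩ hx ⟨b', a'⟩ hx' (rfl : a = a')
    have h := hx.trans hx'.symm
    have h1 := (div_left_inj' (RatFunc.algebraMap_ne_zero (X_pow_add_lowPoly_ne_zero a))).1 h
    exact Prod.ext (lowPoly_injective m (RatFunc.algebraMap_injective ℝ h1)) rfl
  | monic n hn =>
    refine volume_eq_zero_of_injOn_snd hn hs ?_
    rintro ⟨b, a⟩ hx ⟨b', a'⟩ hx' (rfl : a = a')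
    have h := hx.trans hx'.symm
    have h1 := (div_left_inj' (RatFunc.algebraMap_ne_zero (X_pow_add_lowPoly_ne_zero a))).1 h
    exact Prod.ext
      (lowPoly_injective n (add_left_cancel (RatFunc.algebraMap_injective ℝ h1))) rfl

/-! ### Matchings and disjoint paths -/

section Linking

variable {N X : Type*}

/-- The columns of `[I - G, R, H]` belonging to the nodes outside `Y` and the excitations
in `U`. -/
def IsColumn (U : Finset X) (Y : Finset N) : N ⊕ X → Prop
  | .inl j => j ∉ Y
  | .inr u => u ∈ U

/-- A matching between the rows of `[I - G, R, H]` and the columns selected by `U` and `Y`, along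
the edges of the network graph and the diagonal of `I - G`. Here `adj s j` says that there is an
edge from the signal `s` to the node `j`. -/
structure IsMatching (adj : N ⊕ X → N → Prop) (U : Finset X) (Y : Finset N) {ι : Type*}
    (rows : ι → N) (cols : ι → N ⊕ X) : Prop where
  rows_injective : Function.Injective rows
  cols_injective : Function.Injective cols
  isColumn : ∀ i, IsColumn U Y (cols i)
  adj : ∀ i, cols i = .inl (rows i) ∨ adj (cols i) (rows i)

/-- `v 0, …, v l` are the signals along a walk from an excitation in `U` to a node in `Y`. -/
structure IsWalk (adj : N ⊕ X → N → Prop) (U : Finset X) (Y : Finset N) (v : ℕ → N ⊕ X) (l : ℕ) :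
    Prop where
  start_mem : ∃ u ∈ U, v 0 = .inr u
  adj : ∀ k < l, ∃ j, v (k + 1) = .inl j ∧ adj (v k) j
  end_mem : ∃ y ∈ Y, v l = .inl y

variable {adj : N ⊕ X → N → Prop} {U : Finset X} {Y : Finset N}

theorem IsWalk.take {v : ℕ → N ⊕ X} {l : ℕ} (h : IsWalk adj U Y v l) {k : ℕ} (hk : k ≤ l)
    (hy : ∃ y ∈ Y, v k = .inl y) : IsWalk adj U Y v k :=
  ⟨h.start_mem, fun m hm => h.adj m (hm.trans_le hk), hy⟩

/-- A walk that visits a signal twice can be shortened by skipping what lies in between. -/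
theorem IsWalk.splice {v : ℕ → N ⊕ X} {l : ℕ} (h : IsWalk adj U Y v l) {a b : ℕ} (hab : a < b)
    (hb : b ≤ l) (hv : v a = v b) :
    IsWalk adj U Y (fun k => if k ≤ a then v k else v (k + (b - a))) (l - (b - a)) := by
  refine ⟨by simpa using h.start_mem, fun k hk => ?_, ?_⟩
  · rcases lt_trichotomy k a with hka | rfl | hka
    · simpa [hka.le, Nat.succ_le_of_lt hka] using h.adj k (by omega)
    · have h1 : ¬ k + 1 ≤ k := by omega
      have h2 : k + 1 + (b - k) = b + 1 := by omega
      simpa [h1, h2, hv] using h.adj b (by omega)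
    · have h1 : ¬ k + 1 ≤ a := by omega
      have h2 : k + 1 + (b - a) = k + (b - a) + 1 := by omega
      simpa [h1, hka.not_ge, h2] using h.adj (k + (b - a)) (by omega)
  · by_cases hl : l - (b - a) ≤ a
    · have h1 : l = b := by omega
      have h2 : l - (b - a) = a := by omega
      subst h1
      simpa [h2, hv] using h.end_mem
    · have h2 : l - (b - a) + (b - a) = l := by omega
      simpa [hl, h2] using h.end_mem

/-- A shortest walk inside the set of signals of a given one visits no signal twice, and no node
in `Y` before its end. -/
theorem IsWalk.exists_path {v : ℕ → N ⊕ X} {l : ℕ} (h : IsWalk adj U Y v l) :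
    ∃ (w : ℕ → N ⊕ X) (m : ℕ), IsWalk adj U Y w m ∧ (∀ k ≤ m, ∃ k' ≤ l, w k = v k') ∧
      (∀ a ≤ m, ∀ b ≤ m, w a = w b → a = b) ∧ ∀ k < m, ∀ y ∈ Y, w k ≠ .inl y := by
  classical
  have hex : ∃ m w, IsWalk adj U Y w m ∧ ∀ k ≤ m, ∃ k' ≤ l, w k = v k' :=
    ⟨l, v, h, fun k hk => ⟨k, hk, rfl⟩⟩
  obtain ⟨w, hw, hsub⟩ := Nat.find_spec hex
  set m := Nat.find hex
  have hlt : ∀ a b, a < b → b ≤ m → w a ≠ w b := by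
    intro a b hab hb heq
    refine Nat.find_min hex (m := m - (b - a)) (by omega) ⟨_, hw.splice hab hb heq, fun k hk => ?_⟩
    by_cases hka : k ≤ a
    · simpa [hka] using hsub k (by omega)
    · simpa [hka] using hsub (k + (b - a)) (by omega)
  refine ⟨w, m, hw, hsub, fun a ha b hb hab => ?_, fun k hk y hy hk' => ?_⟩
  · rcases lt_trichotomy a b with h' | h' | h'
    · exact absurd hab (hlt a b h' hb)
    · exact h'
    · exact absurd hab.symm (hlt b a h' ha)
  · exact Nat.find_min hex hk ⟨w, hw.take hk.le ⟨y, hy, hk'⟩, fun i hi => hsub i (hi.trans hk.le)⟩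

/-- Disjoint paths yield a matching: the nodes on the paths are matched with their predecessors,
and the remaining nodes outside `Y` with themselves. -/
theorem exists_isMatching_of_disjoint_walks {r : ℕ} (v : Fin r → ℕ → N ⊕ X) (l : Fin r → ℕ)
    (hv : ∀ i, IsWalk adj U Y (v i) (l i))
    (hdisj : ∀ i i', i ≠ i' → ∀ k ≤ l i, ∀ k' ≤ l i', v i k ≠ v i' k') :
    ∃ (rows : {j // j ∉ Y} ⊕ Fin r → N) (cols : {j // j ∉ Y} ⊕ Fin r → N ⊕ X),
      IsMatching adj U Y rows cols := by
  classical
  choose w m hw hsub hinj hY using fun i => (hv i).exists_path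
  have key : ∀ i k i' k', k ≤ m i → k' ≤ m i' → w i k = w i' k' → i = i' ∧ k = k' := by
    intro i k i' k' hk hk' heq
    have hi : i = i' := by
      by_contra hne
      obtain ⟨a, ha, ha'⟩ := hsub i k hk
      obtain ⟨b, hb, hb'⟩ := hsub i' k' hk'
      exact hdisj i i' hne a ha b hb (by rw [← ha', ← hb', heq])
    subst hi
    exact ⟨rfl, hinj i k hk k' hk' heq⟩
  choose e he hwe using fun i => (hw i).end_mem
  choose u hu hwu using fun i => (hw i).start_mem
  have hm : ∀ i, ∃ k, m i = k + 1 := by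
    intro i
    refine Nat.exists_eq_succ_of_ne_zero fun h0 => ?_
    have := hwe i
    rw [h0, hwu] at this
    cases this
  let onPath (j : N) : Prop := ∃ i k, k < m i ∧ w i (k + 1) = .inl j
  -- the predecessor of a node on a path; other nodes are their own partner
  have hpred : ∀ j, ∃ s : N ⊕ X, (∃ i k, k < m i ∧ w i (k + 1) = .inl j ∧ s = w i k) ∨
      (¬ onPath j ∧ s = .inl j) := by
    intro j
    by_cases hj : onPath j
    · obtain ⟨i, k, hk, hj⟩ := hj
      exact ⟨w i k, Or.inl ⟨i, k, hk, hj, rfl⟩⟩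
    · exact ⟨_, Or.inr ⟨hj, rfl⟩⟩
  choose pred hpred using hpred
  -- a signal before the end of a path is an excitation or a node on the path
  have hoff : ∀ i k j, k < m i → w i k = .inl j → onPath j := by
    intro i k j hk hj
    cases k with
    | zero => rw [hwu] at hj; cases hj
    | succ k => exact ⟨i, k, by omega, hj⟩
  have hpred_inj : Function.Injective pred := by
    intro j j' h
    rcases hpred j with ⟨i, k, hk, hj, hs⟩ | ⟨hj, hs⟩ <;>
      rcases hpred j' with ⟨i', k', hk', hj', hs'⟩ | ⟨hj', hs'⟩
    · obtain ⟨rfl, rfl⟩ := key i k i' k' hk.le hk'.le (by rw [← hs, ← hs', h])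
      exact Sum.inl_injective (hj.symm.trans hj')
    · exact absurd (hoff i k j' hk (by rw [← hs, h, hs'])) hj'
    · exact absurd (hoff i' k' j hk' (by rw [← hs', ← h, hs])) hj
    · exact Sum.inl_injective (by rw [← hs, ← hs', h])
  let rows : {j // j ∉ Y} ⊕ Fin r → N := Sum.elim Subtype.val e
  have hrows : Function.Injective rows := by
    refine Subtype.val_injective.sumElim (fun i i' h => ?_) fun a i h => a.2 (h ▸ he i)
    exact (key i (m i) i' (m i') le_rfl le_rfl (by rw [hwe, hwe, h])).1
  refine ⟨rows, fun a => pred (rows a), hrows, hpred_inj.comp hrows, fun a => ?_, fun a => ?_⟩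
  · rcases hpred (rows a) with ⟨i, k, hk, hj, hs⟩ | ⟨hj, hs⟩
    · rw [hs]
      cases hwk : w i k with
      | inl j' => exact fun hj' => hY i k hk j' hj' hwk
      | inr u' =>
        cases k with
        | zero =>
          rw [hwu] at hwk
          exact Sum.inr_injective hwk ▸ hu i
        | succ k =>
          obtain ⟨j', hj', -⟩ := (hw i).adj k (by omega)
          rw [hj'] at hwk
          cases hwk
    · rw [hs]
      rcases a with a | i
      · exact a.2
      · obtain ⟨k, hk⟩ := hm i
        exact absurd ⟨i, k, by omega, by rw [← hk, hwe]; rfl⟩ hj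
  · rcases hpred (rows a) with ⟨i, k, hk, hj, hs⟩ | ⟨hj, hs⟩
    · obtain ⟨j', hj', hadj⟩ := (hw i).adj k hk
      rw [hj] at hj'
      right
      rw [hs, Sum.inl_injective hj']
      exact hadj
    · exact Or.inl hs

/-- A matching of size `|Yᶜ| + r` yields `r` disjoint paths: starting from the matched excitations,
one follows the matching until it ends. At most as many of these paths end outside `Y` as there are
unmatched columns of nodes. -/
theorem exists_disjoint_walks_of_isMatching [Fintype N] [DecidableEq N] {r : ℕ} {ι : Type*}
    [Fintype ι]
    (hcard : Fintype.card {j // j ∉ Y} + r ≤ Fintype.card ι) {rows : ι → N} {cols : ι → N ⊕ X}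
    (h : IsMatching adj U Y rows cols) :
    ∃ (v : Fin r → ℕ → N ⊕ X) (l : Fin r → ℕ), (∀ i, IsWalk adj U Y (v i) (l i)) ∧
      ∀ i i', i ≠ i' → ∀ k ≤ l i, ∀ k' ≤ l i', v i k ≠ v i' k' := by
  classical
  let step (s : N ⊕ X) : N ⊕ X := if hs : ∃ i, cols i = s then .inl (rows hs.choose) else s
  have hstep (i : ι) : step (cols i) = .inl (rows i) := by
    have hs : ∃ i', cols i' = cols i := ⟨i, rfl⟩
    simp only [step, dif_pos hs, h.cols_injective hs.choose_spec]
  let matched : Set (N ⊕ X) := Set.range cols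
  have hstep_inj : Set.InjOn step matched := by
    rintro _ ⟨i, rfl⟩ _ ⟨i', rfl⟩ heq
    rw [hstep, hstep] at heq
    rw [h.rows_injective (Sum.inl_injective heq)]
  -- an excitation is not in the range of `step` on matched signals, so that iterates starting from
  -- matched excitations never meet
  have hkey : ∀ (a b : ℕ) (u u' : X), (∀ k < a, step^[k] (.inr u) ∈ matched) →
      (∀ k < b, step^[k] (.inr u') ∈ matched) → step^[a] (.inr u) = step^[b] (.inr u') →
      a = b ∧ u = u' := by
    intro a
    induction a with
    | zero =>
      intro b u u' _ hb heq
      cases b with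
      | zero => exact ⟨rfl, Sum.inr_injective heq⟩
      | succ b =>
        obtain ⟨i, hi⟩ := hb b (by omega)
        rw [Function.iterate_succ_apply', ← hi, hstep] at heq
        cases heq
    | succ a ih =>
      intro b u u' ha hb heq
      obtain ⟨i, hi⟩ := ha a (by omega)
      cases b with
      | zero =>
        rw [Function.iterate_succ_apply', ← hi, hstep] at heq
        cases heq
      | succ b =>
        rw [Function.iterate_succ_apply', Function.iterate_succ_apply'] at heq
        obtain ⟨h1, h2⟩ := ih b u u' (fun k hk => ha k (by omega)) (fun k hk => hb k (by omega))
          (hstep_inj (ha a (by omega)) (hb b (by omega)) heq)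
        exact ⟨by rw [h1], h2⟩
  have hleave (u : X) : ∃ k, step^[k] (.inr u) ∉ matched := by
    by_contra! hall
    have hinj : Function.Injective fun k => (⟨_, hall k⟩ : matched) := fun a b hab =>
      (hkey a b u u (fun k _ => hall k) (fun k _ => hall k) (congrArg Subtype.val hab)).1
    exact not_injective_infinite_finite _ hinj
  let len (u : X) : ℕ := Nat.find (hleave u)
  have hlen (u : X) : ∀ k < len u, step^[k] (.inr u) ∈ matched := fun k hk =>
    not_not.1 (Nat.find_min (hleave u) hk)
  have hend (u : X) : step^[len u] (.inr u) ∉ matched := Nat.find_spec (hleave u)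
  have hlen_pos (u : X) (hu : Sum.inr u ∈ matched) : ∃ k, len u = k + 1 := by
    refine Nat.exists_eq_succ_of_ne_zero fun h0 => hend u ?_
    rwa [h0]
  have hnode (u : X) (k : ℕ) (hk : k < len u) :
      ∃ i, step^[k] (.inr u) = cols i ∧ step^[k + 1] (.inr u) = .inl (rows i) := by
    obtain ⟨i, hi⟩ := hlen u k hk
    exact ⟨i, hi.symm, by rw [Function.iterate_succ_apply', ← hi, hstep]⟩
  have hmatchedU (u : X) (hu : Sum.inr u ∈ matched) : u ∈ U := by
    obtain ⟨i, hi⟩ := hu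
    have := h.isColumn i
    rwa [hi] at this
  -- every index is a matched node column or a matched excitation that leads to `Y` or to an
  -- unmatched node column
  let good : Set ι := {i | ∃ u, cols i = .inr u ∧ ∃ y ∈ Y, step^[len u] (.inr u) = .inl y}
  have hbad : ∀ i : ι, i ∉ good → ∃ j : {j // j ∉ Y},
      cols i = .inl j.1 ∨ ∃ u, cols i = .inr u ∧ step^[len u] (.inr u) = .inl j.1 := by
    intro i hi
    cases hc : cols i with
    | inl j =>
      have := h.isColumn i
      rw [hc] at this
      exact ⟨⟨j, this⟩, Or.inl rfl⟩
    | inr u =>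
      obtain ⟨k, hk⟩ := hlen_pos u ⟨i, hc⟩
      obtain ⟨i', -, hi'⟩ := hnode u k (by omega)
      rw [← hk] at hi'
      exact ⟨⟨rows i', fun hy => hi ⟨u, hc, _, hy, hi'⟩⟩, Or.inr ⟨u, rfl, hi'⟩⟩
  have hbad_card : Fintype.card {i // i ∉ good} ≤ Fintype.card {j // j ∉ Y} := by
    choose g hg using fun i : {i // i ∉ good} => hbad i.1 i.2
    refine Fintype.card_le_of_injective g fun i i' heq => Subtype.ext (h.cols_injective ?_)
    rcases hg i with hi | ⟨u, hu, hi⟩ <;> rcases hg i' with hi' | ⟨u', hu', hi'⟩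
    · rw [hi, hi', heq]
    · exact absurd ⟨i.1, by rw [hi, heq, hi']⟩ (hend u')
    · exact absurd ⟨i'.1, by rw [hi', ← heq, hi]⟩ (hend u)
    · rw [hu, hu', (hkey _ _ u u' (hlen u) (hlen u') (by rw [hi, hi', heq])).2]
  have hgood_card : r ≤ Fintype.card {i // i ∈ good} := by
    have := Fintype.card_subtype_compl (· ∈ good)
    have := Fintype.card_subtype_le (· ∈ good)
    omega
  obtain ⟨f⟩ : Nonempty (Fin r ↪ {i // i ∈ good}) :=
    Function.Embedding.nonempty_of_card_le (by simpa using hgood_card)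
  choose u hu y hy huy using fun i => (f i).2
  refine ⟨fun i k => step^[k] (.inr (u i)), fun i => len (u i), fun i => ⟨?_, fun k hk => ?_, ?_⟩,
    fun i i' hne k hk k' hk' heq => hne ?_⟩
  · exact ⟨u i, hmatchedU _ ⟨_, hu i⟩, rfl⟩
  · obtain ⟨a, ha, ha'⟩ := hnode (u i) k hk
    refine ⟨rows a, ha', ?_⟩
    rcases h.adj a with hd | hd
    · -- a matched diagonal position would make the iteration stationary
      have := (hkey k (k + 1) (u i) (u i) (fun m hm => hlen _ m (hm.trans hk))
        (fun m hm => hlen _ m ((Nat.lt_succ_iff.1 hm).trans_lt hk)) (by rw [ha, ha', hd])).1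
      omega
    · rw [← ha] at hd
      exact hd
  · exact ⟨y i, hy i, huy i⟩
  · have := (hkey k k' (u i) (u i') (fun m hm => hlen _ m (hm.trans_le hk))
      (fun m hm => hlen _ m (hm.trans_le hk')) heq).2
    exact f.injective (Subtype.ext (h.cols_injective (by rw [hu, hu, this])))

end Linking

/-! ### The rank of the transfer matrix and the rank of `[I - G, R, H]` -/

section BlockRank

variable {𝕜 : Type*} [Field 𝕜]

theorem rank_fromRows_le {m₁ m₂ n : Type*} [Fintype m₁] [Fintype m₂] [Fintype n]
    (A : Matrix m₁ n 𝕜) (B : Matrix m₂ n 𝕜) :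
    (Matrix.fromRows A B).rank ≤ Fintype.card m₁ + B.rank := by
  rw [Matrix.rank_eq_finrank_span_row, Matrix.rank_eq_finrank_span_row]
  have h : Set.range (Matrix.fromRows A B).row = Set.range A.row ∪ Set.range B.row := by
    exact Set.Sum.elim_range _ _
  rw [h, Submodule.span_union]
  refine (Submodule.finrank_add_le_finrank_add_finrank _ _).trans ?_
  gcongr
  exact finrank_range_le_card _

theorem rank_fromBlocks_one_zero {m n k : Type*} [Fintype m] [DecidableEq m] [Fintype n]
    [Fintype k] (E : Matrix m k 𝕜) (D : Matrix n k 𝕜) :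
    (Matrix.fromBlocks (1 : Matrix m m 𝕜) E 0 D).rank = Fintype.card m + D.rank := by
  classical
  apply le_antisymm
  · rw [← Matrix.fromRows_fromCols_eq_fromBlocks]
    refine (rank_fromRows_le _ _).trans ?_
    have h : Matrix.fromCols (0 : Matrix n m 𝕜) D = D * Matrix.fromCols (0 : Matrix k m 𝕜) 1 := by
      rw [Matrix.mul_fromCols, Matrix.mul_zero, Matrix.mul_one]
    rw [h]
    gcongr
    exact Matrix.rank_mul_le_left _ _
  · obtain ⟨f, g, hfg⟩ := exists_submatrix_det_ne_zero D
    have h : ((Matrix.fromBlocks (1 : Matrix m m 𝕜) E 0 D).submatrix (Sum.map id f)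
        (Sum.map id g)).det ≠ 0 := by
      have h' : (Matrix.fromBlocks (1 : Matrix m m 𝕜) E 0 D).submatrix (Sum.map id f)
          (Sum.map id g) =
          Matrix.fromBlocks 1 (E.submatrix id g) 0 (D.submatrix f g) := by
        ext (i | i) (j | j) <;> simp [Matrix.one_apply]
      rw [h', Matrix.det_fromBlocks_zero₂₁, Matrix.det_one, one_mul]
      exact hfg
    simpa using card_le_rank_of_submatrix_det_ne_zero _ h

/-- The rank of a submatrix of `S⁻¹ B` in terms of a submatrix of `[S B]`: multiplied by `S⁻¹`, the
selected columns of `[S B]` become `[1 E; 0 D]`, where `D` is the submatrix of `S⁻¹ B`. -/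
theorem rank_submatrix_fromCols {N X : Type*} [Fintype N] [DecidableEq N] [Fintype X]
    {S : Matrix N N 𝕜} (hS : IsUnit S.det) (B : Matrix N X 𝕜) (U : Finset X) (Y : Finset N) :
    ((Matrix.fromCols S B).submatrix id
      (Sum.map Subtype.val Subtype.val : {j // j ∉ Y} ⊕ U → N ⊕ X)).rank =
      Fintype.card {j // j ∉ Y} +
        ((S⁻¹ * B).submatrix (Subtype.val : Y → N) (Subtype.val : U → X)).rank := by
  set c : {j // j ∉ Y} ⊕ U → N ⊕ X := Sum.map Subtype.val Subtype.val
  have h1 : (Matrix.fromCols S B).submatrix id c =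
      S * (Matrix.fromCols 1 (S⁻¹ * B)).submatrix id c := by
    have : Matrix.fromCols S B = S * Matrix.fromCols 1 (S⁻¹ * B) := by
      rw [Matrix.mul_fromCols, Matrix.mul_one, Matrix.mul_nonsing_inv_cancel_left _ _ hS]
    rw [this]
    rfl
  rw [h1, Matrix.rank_mul_eq_right_of_isUnit_det _ _ hS]
  let e : {j // j ∉ Y} ⊕ Y ≃ N := (Equiv.sumComm _ _).trans (Equiv.sumCompl (· ∈ Y))
  rw [← Matrix.rank_submatrix _ e (Equiv.refl _), ← rank_fromBlocks_one_zero
    ((S⁻¹ * B).submatrix (Subtype.val : {j // j ∉ Y} → N) (Subtype.val : U → X))]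
  congr 1
  ext (i | i) (j | j)
  · simp [e, c, Matrix.one_apply, Subtype.ext_iff]
  · simp [e, c]
  · have : (i : N) ≠ j := fun h => j.2 (h ▸ i.2)
    simp [e, c, this]
  · simp [e, c]

end BlockRank

/-- The matrix `[I - G, R, H]` with given entries of `G`, `R` and `H`. -/
def systemMatrix {A : Type*} [Ring A] {L K p : ℕ} (x : Fin L × Signal L K p → A) :
    Matrix (Fin L) (Signal L K p) A :=
  Matrix.fromCols (1 - Matrix.of fun j l => x (j, Sum.inl l))
    (Matrix.of fun j u => x (j, Sum.inr u))

/-- Changing an entry of `G`, `R` or `H` changes the same entry of `[I - G, R, H]`, with the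
opposite sign in the case of `G`. -/
theorem systemMatrix_add {A : Type*} [Ring A] {L K p : ℕ} (x z : Fin L × Signal L K p → A)
    (j : Fin L) (s : Signal L K p) :
    systemMatrix (fun e => x e + Sum.elim (fun _ => -1) (fun _ => 1) e.2 * z e) j s =
      systemMatrix x j s + z (j, s) := by
  rcases s with l | u
  · simp [systemMatrix]
    abel
  · simp [systemMatrix]

namespace NetworkModelSet

variable {L K p : ℕ} (M : NetworkModelSet L K p)

/-- The edges of the network graph as a relation between signals and nodes. -/
def IsEdge (s : Signal L K p) (j : Fin L) : Prop := ∃ θ ∈ M.Θ, M.direct θ j s ≠ 0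

/-- The matrix `[I - G, R, H]` of the model `M(θ)`. -/
noncomputable def system (θ : Params M.entry M.d) : Matrix (Fin L) (Signal L K p) (RatFunc ℝ) :=
  systemMatrix fun e => (M.entry e).eval (θ.1 e)

/-- The rank of `T_{YU}` is read off the columns of `[I - G, R, H]` belonging to the nodes outside
`Y` and the excitations in `U`. -/
theorem rank_system {θ : Params M.entry M.d} (hθ : θ ∈ M.Θ) (U : Finset (Excitation K p))
    (Y : Finset (Fin L)) :
    ((M.system θ).submatrix id
      (Sum.map Subtype.val Subtype.val : {j // j ∉ Y} ⊕ U → Signal L K p)).rank =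
      Fintype.card {j // j ∉ Y} + (M.transferYU U Y θ).rank := by
  have h := rank_submatrix_fromCols (M.isNetworkModel θ hθ).isUnit_det
    (Matrix.of fun j u => M.direct θ j (Sum.inr u)) U Y
  have hRH : (Matrix.of fun j u => M.direct θ j (Sum.inr u)) =
      Matrix.fromCols (M.model θ).R (M.model θ).H := by
    ext j (k | l) <;> rfl
  rw [transferYU, NetworkData.transfer, ← hRH]
  exact h

theorem nonempty_Θ : M.Θ.Nonempty := by
  rw [Set.nonempty_iff_ne_empty]
  intro h
  exact M.volume_ne_zero (by rw [h, measure_empty])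

theorem hasDisjointPaths_iff {U : Finset (Excitation K p)} {Y : Finset (Fin L)} {n : ℕ} :
    M.HasDisjointPaths U Y n ↔ ∃ (v : Fin n → ℕ → Signal L K p) (l : Fin n → ℕ),
      (∀ i, IsWalk M.IsEdge U Y (v i) (l i)) ∧
        ∀ i i', i ≠ i' → ∀ k ≤ l i, ∀ k' ≤ l i', v i k ≠ v i' k' := by
  constructor
  · rintro ⟨P, hP, hdisj⟩
    have hwalk : ∀ i, ∃ v l, IsWalk M.IsEdge U Y v l ∧ ∀ k ≤ l, v k ∈ P i := by
      intro i
      obtain ⟨hchain, ⟨u, hu, hhead⟩, y, hy, hlast⟩ := hP i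
      have hpos : 0 < (P i).length := by
        rw [List.length_pos_iff]
        rintro h
        simp [h] at hhead
      have hget : ∀ k (hk : k < (P i).length), (P i).getD k (.inr u) = (P i)[k] := fun k hk =>
        List.getD_eq_getElem _ _ hk
      refine ⟨fun k => (P i).getD k (.inr u), (P i).length - 1, ⟨⟨u, hu, ?_⟩, fun k hk => ?_,
        y, hy, ?_⟩, fun k hk => ?_⟩
      · rw [List.head?_eq_getElem?] at hhead
        simp [List.getD, hhead]
      · obtain ⟨j, hj, θ, hθ, hne⟩ := List.isChain_iff_getElem.1 hchain k (by omega)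
        refine ⟨j, ?_, θ, hθ, ?_⟩
        · rw [hget _ (by omega), hj]
        · rwa [hget _ (by omega)]
      · rw [List.getLast?_eq_getElem?] at hlast
        simp [List.getD, hlast]
      · beta_reduce
        rw [hget _ (by omega)]
        exact List.getElem_mem _
    choose v l hv hmem using hwalk
    exact ⟨v, l, hv, fun i i' hne k hk k' hk' heq =>
      hdisj i i' hne (hmem i k hk) (heq ▸ hmem i' k' hk')⟩
  · rintro ⟨v, l, hv, hdisj⟩
    refine ⟨fun i => (List.range (l i + 1)).map (v i), fun i => ⟨?_, ?_, ?_⟩, fun i i' hne => ?_⟩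
    · rw [List.isChain_map, List.isChain_range_succ]
      intro k hk
      obtain ⟨j, hj, hadj⟩ := (hv i).adj k hk
      exact ⟨j, hj, hadj⟩
    · obtain ⟨u, hu, h0⟩ := (hv i).start_mem
      exact ⟨u, hu, by simp [List.range_succ_eq_map, h0]⟩
    · obtain ⟨y, hy, h0⟩ := (hv i).end_mem
      exact ⟨y, hy, by simp [List.range_succ, h0]⟩
    · rw [List.disjoint_left]
      intro s hs hs'
      obtain ⟨k, hk, rfl⟩ := List.mem_map.1 hs
      obtain ⟨k', hk', h⟩ := List.mem_map.1 hs'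
      rw [List.mem_range] at hk hk'
      exact hdisj i i' hne k (by omega) k' (by omega) h.symm

/-! ### Generic nonsingularity along a matching -/

variable {M} in
/-- There are transfer functions in place of the parametrized ones that make the submatrix of
`[I - G, R, H]` belonging to a matching nonsingular: `0` outside the matching and a suitable common
value, up to sign, on it. -/
theorem exists_systemMatrix_det_ne_zero (hknown : M.KnownNondegenerate) {ι : Type*} [Fintype ι]
    [DecidableEq ι] {U : Finset (Excitation K p)} {Y : Finset (Fin L)} {rows : ι → Fin L}
    {cols : ι → Signal L K p} (h : IsMatching M.IsEdge U Y rows cols) :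
    ∃ y : Fin L × Signal L K p → RatFunc ℝ, (∀ e f, M.entry e = .fixed f → y e = f) ∧
      ((systemMatrix y).submatrix rows cols).det ≠ 0 := by
  classical
  let q (i : ι) : Prop := ∀ f, M.entry (rows i, cols i) ≠ .fixed f
  have hdiag (i : ι) (hi : ¬ q i) : M.knownPart (rows i) (cols i) ≠ 0 := by
    simp only [q, not_forall, not_not] at hi
    obtain ⟨f, hf⟩ := hi
    obtain ⟨θ₀, hθ₀⟩ := M.nonempty_Θ
    have hval (θ : Params M.entry M.d) : M.direct θ (rows i) (cols i) = f :=
      Entry.eval_of_eq_fixed hf _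
    rcases eq_or_ne (cols i) (.inl (rows i)) with hc | hc
    · have hz : f = 0 := by
        rw [← hval θ₀, hc]
        exact (M.isNetworkModel θ₀ hθ₀).diag_zero (rows i)
      rw [hc] at hf ⊢
      simp [knownPart, hf, hz, Entry.known]
    · obtain ⟨θ, -, hθ⟩ := (h.adj i).resolve_left hc
      rw [hval] at hθ
      cases hs : cols i with
      | inl l =>
        have hl : rows i ≠ l := fun h => hc (by rw [hs, h])
        rw [hs] at hf
        simp [knownPart, hf, hθ, Entry.known, hl]
      | inr u =>
        rw [hs] at hf
        simp [knownPart, hf, hθ, Entry.known]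
  have hminor : ((M.knownPart.submatrix rows cols).submatrix
      (Subtype.val : {i // ¬ q i} → ι) Subtype.val).det ≠ 0 := by
    let e := (Fintype.equivFin {i // ¬ q i}).symm
    rw [← Matrix.det_submatrix_equiv_self e]
    exact hknown _ (fun i => rows (e i)) (fun i => cols (e i))
      (h.rows_injective.comp (Subtype.val_injective.comp e.injective))
      (h.cols_injective.comp (Subtype.val_injective.comp e.injective)) fun i => hdiag _ (e i).2
  obtain ⟨c, hc⟩ := exists_det_add_diagonal_ne_zero _ q hminor
  let z (e : Fin L × Signal L K p) : RatFunc ℝ := if ∃ i, q i ∧ e = (rows i, cols i) then c else 0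
  refine ⟨fun e => (M.entry e).known + Sum.elim (fun _ => -1) (fun _ => 1) e.2 * z e,
    fun e f hf => ?_, ?_⟩
  · have hz : z e = 0 := if_neg (by rintro ⟨i, hi, rfl⟩; exact hi f hf)
    simp [hf, hz, Entry.known]
  · suffices hsum : (systemMatrix fun e => (M.entry e).known +
        Sum.elim (fun _ => -1) (fun _ => 1) e.2 * z e).submatrix rows cols =
          M.knownPart.submatrix rows cols + Matrix.diagonal fun i => if q i then c else 0 by
      rwa [hsum]
    ext i i'
    rw [Matrix.submatrix_apply, systemMatrix_add]
    refine congrArg₂ (· + ·) rfl ?_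
    simp only [z, Matrix.diagonal_apply, Prod.mk.injEq]
    by_cases hii : i = i'
    · subst hii
      rw [if_pos rfl]
      refine if_congr ⟨?_, fun hi => ⟨i, hi, rfl, rfl⟩⟩ rfl rfl
      rintro ⟨a, ha, hr, -⟩
      rwa [h.rows_injective hr]
    · rw [if_neg hii, if_neg]
      rintro ⟨a, -, hr, hs⟩
      exact hii ((h.rows_injective hr).trans (h.cols_injective hs).symm)

variable {M} in
/-- The submatrix of `[I - G, R, H]` belonging to a matching is nonsingular for almost all parameter
vectors, whether in `Θ` or not. -/
theorem ae_system_det_ne_zero (hknown : M.KnownNondegenerate) {ι : Type*} [Fintype ι]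
    [DecidableEq ι] {U : Finset (Excitation K p)} {Y : Finset (Fin L)} {rows : ι → Fin L}
    {cols : ι → Signal L K p} (h : IsMatching M.IsEdge U Y rows cols) :
    ∀ᵐ θ : Params M.entry M.d, ((M.system θ).submatrix rows cols).det ≠ 0 := by
  obtain ⟨y, hy, hdet⟩ := exists_systemMatrix_det_ne_zero hknown h
  set P : MvPolynomial (Fin L × Signal L K p) (RatFunc ℝ) :=
    ((systemMatrix MvPolynomial.X).submatrix rows cols).det
  have hP (x : Fin L × Signal L K p → RatFunc ℝ) :
      MvPolynomial.eval x P = ((systemMatrix x).submatrix rows cols).det := by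
    simp only [P, RingHom.map_det]
    congr 1
    ext i j
    cases hs : cols j <;> simp [systemMatrix, hs, Matrix.one_apply, apply_ite]
  have hae := ae_eval_ne_zero (x := fun e => (M.entry e).eval)
    (fun e => measurableFamily_eval (M.entry e)) P y (by rwa [hP]) fun e => ?_
  · have hae' : ∀ᵐ θ : Params M.entry M.d,
        MvPolynomial.eval (fun e => (M.entry e).eval (θ.1 e)) P ≠ 0 :=
      (Measure.quasiMeasurePreserving_fst (μ := volume)
      (ν := (volume : Measure (Fin M.d → ℝ)))).ae hae
    filter_upwards [hae'] with θ hθ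
    rwa [hP] at hθ
  · by_cases he : ∃ f, M.entry e = .fixed f
    · obtain ⟨f, hf⟩ := he
      refine Or.inl fun t => ?_
      rw [hy e f hf, Entry.eval_of_eq_fixed hf]
    · push Not at he
      exact Or.inr (volume_eval_eq he)

/-! ### Generic rank and disjoint paths -/

variable {M} in
/-- Disjoint paths bound the rank from below, generically. -/
theorem ae_le_rank (hknown : M.KnownNondegenerate) {U : Finset (Excitation K p)}
    {Y : Finset (Fin L)} {n : ℕ} (h : M.HasDisjointPaths U Y n) :
    ∀ᵐ θ : Params M.entry M.d, θ ∈ M.Θ → n ≤ (M.transferYU U Y θ).rank := by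
  obtain ⟨v, l, hv, hdisj⟩ := M.hasDisjointPaths_iff.1 h
  obtain ⟨rows, cols, hmatch⟩ := exists_isMatching_of_disjoint_walks v l hv hdisj
  have hcols : ∀ i, ∃ c : {j // j ∉ Y} ⊕ U, Sum.map Subtype.val Subtype.val c = cols i := by
    intro i
    have hi := hmatch.isColumn i
    cases hc : cols i with
    | inl j => exact ⟨.inl ⟨j, by rwa [hc] at hi⟩, rfl⟩
    | inr u => exact ⟨.inr ⟨u, by rwa [hc] at hi⟩, rfl⟩
  choose c hc using hcols
  filter_upwards [ae_system_det_ne_zero hknown hmatch] with θ hdet hθ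
  have hsub : (M.system θ).submatrix rows cols = ((M.system θ).submatrix id
      (Sum.map Subtype.val Subtype.val)).submatrix rows c := by
    ext i j
    simp [hc]
  rw [hsub] at hdet
  have hle := card_le_rank_of_submatrix_det_ne_zero _ hdet
  rw [M.rank_system hθ, Fintype.card_sum, Fintype.card_fin] at hle
  omega

/-- In every model of the set there are as many disjoint paths as the rank: a nonzero minor has a
nonzero Leibniz term, and the positions of its factors form a matching. -/
theorem hasDisjointPaths_rank {θ : Params M.entry M.d} (hθ : θ ∈ M.Θ)
    (U : Finset (Excitation K p)) (Y : Finset (Fin L)) :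
    M.HasDisjointPaths U Y (M.transferYU U Y θ).rank := by
  obtain ⟨f, g, hfg⟩ := exists_submatrix_det_ne_zero ((M.system θ).submatrix id
    (Sum.map Subtype.val Subtype.val : {j // j ∉ Y} ⊕ U → Signal L K p))
  obtain ⟨σ, hσ⟩ := exists_perm_ne_zero_of_det_ne_zero hfg
  obtain ⟨hf, hg⟩ := injective_of_submatrix_det_ne_zero hfg
  refine M.hasDisjointPaths_iff.2 (exists_disjoint_walks_of_isMatching
    (by rw [Fintype.card_fin, M.rank_system hθ]) (rows := f ∘ σ)
    (cols := Sum.map Subtype.val Subtype.val ∘ g) ⟨hf.comp σ.injective,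
      (Subtype.val_injective.sumMap Subtype.val_injective).comp hg, fun i => ?_, fun i => ?_⟩)
  · cases hgi : g i with
    | inl j =>
      rw [Function.comp_apply, hgi]
      exact j.2
    | inr u =>
      rw [Function.comp_apply, hgi]
      exact u.2
  · have hne := hσ i
    cases hgi : g i with
    | inl j =>
      by_cases hj : (j : Fin L) = f (σ i)
      · left
        simp [hgi, hj]
      · right
        refine ⟨θ, hθ, fun h0 => hne ?_⟩
        simp only [Function.comp_apply, hgi, Sum.map_inl] at h0
        change M.system θ (f (σ i)) (Sum.map _ _ (g i)) = 0
        rw [hgi]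
        have hj' : f (σ i) ≠ j := fun h => hj h.symm
        change (1 : Matrix (Fin L) (Fin L) (RatFunc ℝ)) (f (σ i)) j -
          M.direct θ (f (σ i)) (Sum.inl j) = 0
        rw [Matrix.one_apply_ne hj', zero_sub, h0, neg_zero]
    | inr u =>
      right
      refine ⟨θ, hθ, fun h0 => hne ?_⟩
      simp only [Function.comp_apply, hgi, Sum.map_inr] at h0
      change M.system θ (f (σ i)) (Sum.map _ _ (g i)) = 0
      rw [hgi]
      exact h0

end NetworkModelSet
end DynNet

theorem mainTheorem3 {L K p : ℕ} (M : DynNet.NetworkModelSet L K p)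
    (hstrict : M.StrictlyProperModules) (hknown : M.KnownNondegenerate)
    (U : Finset (DynNet.Excitation K p)) (Y : Finset (Fin L)) :
    ∃ k : ℕ, IsGreatest {n | M.HasDisjointPaths U Y n} k ∧ M.IsGenericRank U Y k := by
  -- `Θ` is not null, so that it contains parameters where the rank is at least `n`
  have hbdd : ∀ n, M.HasDisjointPaths U Y n → n ≤ Y.card := by
    intro n hn
    by_contra hlt
    have hae := DynNet.NetworkModelSet.ae_le_rank hknown hn
    refine M.volume_ne_zero (measure_mono_null (fun θ hθ => ?_) (ae_iff.1 hae))
    refine fun hle => hlt ?_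
    exact (hle hθ).trans ((Matrix.rank_le_card_height _).trans_eq (Fintype.card_coe Y))
  obtain ⟨θ₀, hθ₀⟩ := M.nonempty_Θ
  have hgreatest := Nat.sSup_mem ⟨_, M.hasDisjointPaths_rank hθ₀ U Y⟩ ⟨_, hbdd⟩
  refine ⟨_, ⟨hgreatest, fun n hn => le_csSup ⟨_, hbdd⟩ hn⟩, ?_⟩
  filter_upwards [DynNet.NetworkModelSet.ae_le_rank hknown hgreatest] with θ hθ hmem
  exact le_antisymm (le_csSup ⟨_, hbdd⟩ (M.hasDisjointPaths_rank hmem U Y)) (hθ hmem)
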